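/- Let $E\subset\mathbb{R}^2$ be the spiral-type domain given in polar coordinates $(r,\theta)$ by $$E:=\Big\{(r\cos\theta,\,r\sin\theta):\ 2\pi\le\theta<\infty,\ \frac{1}{(\theta+\pi)\log^2(\theta+\pi)}\le r<\frac{1}{\theta\log^2\theta}\Big\},$$ where $\log$ is the natural logarithm. Then the characteristic function $\mathbf{1}_E$ belongs to the Besov space $B^{1/p}_{p,\infty}(\mathbb{R}^2)$ for every $p\in[1,\infty]$ (with $1/\infty:=0$). Here, for $s\in\mathbb{R}$ and $p\in(0,\infty]$, $B^{s}_{p,\infty}(\mathbb{R}^n)$ is the space of all $f\in\mathcal{S}'(\mathbb{R}^n)$ with $$\sup_{j\in\mathbb{N}_0}2^{js}\,\|\varphi_j*f\|_{L^p(\mathbb{R}^n)}<\infty,$$ where $\varphi_j:=2^{jn}\varphi(2^j\cdot)$ for $j\ge1$ and $\varphi_0,\varphi\in\mathcal{S}(\mathbb{R}^n)$ have real-valued nonnegative Fourier transforms $\mathcal{F}\varphi_0,\mathcal{F}\varphi$ (with $\mathcal{F}\psi(\xi)=(2\pi)^{-n/2}\int_{\mathbb{R}^n}e^{-ix\cdot\xi}\psi(x)\,dx$)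 such that, for some constant $C>0$, $\operatorname{supp}\mathcal{F}\varphi_0\subset\{|\xi|\le2\}$ and $\mathcal{F}\varphi_0\ge C$ on $\{|\xi|\le\frac53\}$, while $\operatorname{supp}\mathcal{F}\varphi\subset\{\frac12\le|\xi|\le2\}$ and $\mathcal{F}\varphi\ge C$ on $\{\frac35\le|\xi|\le\frac53\}$. The assertion holds for every such pair $(\varphi_0,\varphi)$. -/

import Mathlib

open MeasureTheory SchwartzMap
open scoped ENNReal

noncomputable section

namespace SpiralBesov

/-- `ℝⁿ` with its Euclidean norm. -/
abbrev Rn (n : ℕ) : Type := EuclideanSpace ℝ (Fin n)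

/-- The Fourier transform `(2π)^{-n/2} ∫ e^{-i x·ξ} φ(x) dx`. -/
def fourierT {n : ℕ} (φ : 𝓢(Rn n, ℂ)) (ξ : Rn n) : ℂ :=
  (((2 * Real.pi) ^ (-(n : ℝ) / 2) : ℝ) : ℂ) *
    ∫ x : Rn n, Complex.exp (-Complex.I * ((inner ℝ x ξ : ℝ) : ℂ)) * φ x

/-- Admissible pairs `(φ₀, φ)` generating a dyadic resolution in frequency: the Fourier transforms
are real-valued and nonnegative, are supported in `{|ξ| ≤ 2}` and `{1/2 ≤ |ξ| ≤ 2}`, and are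
bounded below by a positive constant on `{|ξ| ≤ 5/3}` and `{3/5 ≤ |ξ| ≤ 5/3}`, respectively. -/
structure IsAdmissible {n : ℕ} (φ₀ φ : 𝓢(Rn n, ℂ)) : Prop where
  im_zero : ∀ ξ, (fourierT φ₀ ξ).im = 0
  im : ∀ ξ, (fourierT φ ξ).im = 0
  nonneg_zero : ∀ ξ, 0 ≤ (fourierT φ₀ ξ).re
  nonneg : ∀ ξ, 0 ≤ (fourierT φ ξ).re
  supp_zero : tsupport (fourierT φ₀) ⊆ {ξ | ‖ξ‖ ≤ 2}
  supp : tsupport (fourierT φ) ⊆ {ξ | 1 / 2 ≤ ‖ξ‖ ∧ ‖ξ‖ ≤ 2}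
  lower : ∃ C : ℝ, 0 < C ∧ (∀ ξ, ‖ξ‖ ≤ 5 / 3 → C ≤ ‖fourierT φ₀ ξ‖) ∧
    ∀ ξ, 3 / 5 ≤ ‖ξ‖ → ‖ξ‖ ≤ 5 / 3 → C ≤ ‖fourierT φ ξ‖

/-- The rescaled Schwartz function `x ↦ 2^{jn} φ(2^j x)`. -/
def dilate {n : ℕ} (φ : 𝓢(Rn n, ℂ)) (j : ℕ) : 𝓢(Rn n, ℂ) :=
  ((2 : ℂ) ^ (j * n)) • SchwartzMap.compCLMOfContinuousLinearEquiv ℂ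
    (ContinuousLinearEquiv.smulLeft (Units.mk0 ((2 : ℝ) ^ j) (by positivity)) :
      Rn n ≃L[ℝ] Rn n) φ

/-- The sequence `φ₀, φ₁, φ₂, …` with `φ_j = 2^{jn} φ(2^j ·)` for `j ≥ 1`. -/
def resolution {n : ℕ} (φ₀ φ : 𝓢(Rn n, ℂ)) (j : ℕ) : 𝓢(Rn n, ℂ) :=
  if j = 0 then φ₀ else dilate φ j

/-- The Schwartz function `y ↦ φ(x - y)`. -/
def reflectAt {n : ℕ} (φ : 𝓢(Rn n, ℂ)) (x : Rn n) : 𝓢(Rn n, ℂ) :=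
  SchwartzMap.compSubConstCLM ℂ x
    (SchwartzMap.compCLMOfContinuousLinearEquiv ℂ (ContinuousLinearEquiv.neg ℝ) φ)

/-- The convolution `φ ∗ f` of a Schwartz function with a tempered distribution, as a function. -/
def conv {n : ℕ} (φ : 𝓢(Rn n, ℂ)) (f : 𝓢'(Rn n, ℂ)) (x : Rn n) : ℂ :=
  f (reflectAt φ x)

/-- The Besov (quasi-)norm `‖f‖_{B^s_{p,q}(ℝⁿ)}` of a tempered distribution with respect to the
pair `(φ₀, φ)`, for `p, q ∈ (0, ∞]`. -/
def besovNorm {n : ℕ} (φ₀ φ : 𝓢(Rn n, ℂ)) (s : ℝ) (p q : ℝ≥0∞) (f : 𝓢'(Rn n, ℂ)) : ℝ≥0∞ :=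
  if q = ∞ then
    ⨆ j : ℕ, ENNReal.ofReal (2 ^ (j * s)) * eLpNorm (conv (resolution φ₀ φ j) f) p volume
  else
    (∑' j : ℕ, (ENNReal.ofReal (2 ^ (j * s)) *
      eLpNorm (conv (resolution φ₀ φ j) f) p volume) ^ q.toReal) ^ (1 / q.toReal)

/-- The Besov space `B^s_{p,q}(ℝⁿ)`, defined by means of the pair `(φ₀, φ)`. -/
def besovSpace {n : ℕ} (φ₀ φ : 𝓢(Rn n, ℂ)) (s : ℝ) (p q : ℝ≥0∞) : Set 𝓢'(Rn n, ℂ) :=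
  {f | besovNorm φ₀ φ s p q f < ∞}

/-- The tempered distribution `T` is the regular distribution given by the function `g`. -/
def IsRegularDistribution {n : ℕ} (T : 𝓢'(Rn n, ℂ)) (g : Rn n → ℂ) : Prop :=
  ∀ ψ : 𝓢(Rn n, ℂ), Integrable (fun x => g x * ψ x) ∧ T ψ = ∫ x, g x * ψ x

/-- The spiral-type domain, in polar coordinates `(r, θ)`:
`1 / ((θ + π) log² (θ + π)) ≤ r < 1 / (θ log² θ)`, `2π ≤ θ < ∞`. -/
def spiralDomain : Set (Rn 2) :=
  {x | ∃ r θ : ℝ, 2 * Real.pi ≤ θ ∧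
    1 / ((θ + Real.pi) * Real.log (θ + Real.pi) ^ 2) ≤ r ∧
    r < 1 / (θ * Real.log θ ^ 2) ∧
    x = !₂[r * Real.cos θ, r * Real.sin θ]}

/-! The pointwise formulas, and existence of admissible pairs. -/

theorem resolution_apply {n : ℕ} (φ₀ φ : 𝓢(Rn n, ℂ)) (j : ℕ) (hj : j ≠ 0) (x : Rn n) :
    resolution φ₀ φ j x = 2 ^ (j * n) * φ ((2 : ℝ) ^ j • x) := by
  simp [resolution, hj, dilate]

theorem reflectAt_apply {n : ℕ} (φ : 𝓢(Rn n, ℂ)) (x y : Rn n) :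
    reflectAt φ x y = φ (x - y) := by
  simp [reflectAt]

theorem fourierT_eq {n : ℕ} (φ : 𝓢(Rn n, ℂ)) (ξ : Rn n) :
    fourierT φ ξ = (((2 * Real.pi) ^ (-(n : ℝ) / 2) : ℝ) : ℂ) *
      FourierTransform.fourier φ ((2 * Real.pi)⁻¹ • ξ) := by
  rw [fourierT, SchwartzMap.fourier_coe, Real.fourier_eq']
  congr 1
  refine integral_congr_ae (Filter.Eventually.of_forall fun x => ?_)
  simp only [smul_eq_mul, inner_smul_right]
  congr 2
  have : (Real.pi : ℂ) ≠ 0 := by exact_mod_cast Real.pi_ne_zero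
  push_cast
  field_simp

theorem exists_fourierT_eq {n : ℕ} (g : Rn n → ℝ) (hg : ContDiff ℝ (⊤ : ℕ∞) g)
    (hc : HasCompactSupport g) :
    ∃ φ : 𝓢(Rn n, ℂ), ∀ ξ, fourierT φ ξ = ((g ξ : ℝ) : ℂ) := by
  have hpi : (2 * Real.pi) ≠ 0 := by positivity
  set c : ℝ := (2 * Real.pi) ^ (-(n : ℝ) / 2) with hcdef
  have hc0 : (c : ℂ) ≠ 0 := by
    have : 0 < c := by positivity
    exact_mod_cast this.ne'
  let G : Rn n → ℂ := fun η => (c : ℂ)⁻¹ * ((g ((2 * Real.pi) • η) : ℝ) : ℂ)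
  have hG : ContDiff ℝ (⊤ : ℕ∞) G :=
    contDiff_const.mul (Complex.ofRealCLM.contDiff.comp (hg.comp (contDiff_const_smul _)))
  have hGc : HasCompactSupport G := by
    have h1 : HasCompactSupport (fun η : Rn n => g ((2 * Real.pi) • η)) :=
      hc.comp_homeomorph (Homeomorph.smulOfNeZero (2 * Real.pi) hpi)
    exact (h1.comp_left (g := fun t : ℝ => (t : ℂ)) (by simp)).mul_left
  refine ⟨FourierTransformInv.fourierInv (hGc.toSchwartzMap hG), fun ξ => ?_⟩
  rw [fourierT_eq, FourierTransform.fourier_fourierInv_eq]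
  change (c : ℂ) * ((c : ℂ)⁻¹ * ((g ((2 * Real.pi) • (2 * Real.pi)⁻¹ • ξ) : ℝ) : ℂ)) = _
  rw [smul_inv_smul₀ hpi, mul_inv_cancel_left₀ hc0]

theorem exists_isAdmissible (n : ℕ) : ∃ φ₀ φ : 𝓢(Rn n, ℂ), IsAdmissible φ₀ φ := by
  let b : ContDiffBump (0 : Rn n) := ⟨5 / 3, 2, by norm_num, by norm_num⟩
  let a : ContDiffBump (0 : Rn n) := ⟨1 / 2, 3 / 5, by norm_num, by norm_num⟩
  obtain ⟨φ₀, h₀⟩ := exists_fourierT_eq (fun ξ => b ξ) b.contDiff b.hasCompactSupport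
  obtain ⟨φ, h⟩ := exists_fourierT_eq (fun ξ => b ξ * (1 - a ξ))
    (b.contDiff.mul (contDiff_const.sub a.contDiff)) b.hasCompactSupport.mul_right
  have hb1 : ∀ ξ : Rn n, ‖ξ‖ ≤ 5 / 3 → b ξ = 1 := fun ξ hξ =>
    b.one_of_mem_closedBall (by simpa using hξ)
  have hb0 : ∀ ξ : Rn n, 2 < ‖ξ‖ → b ξ = 0 := fun ξ hξ =>
    b.zero_of_le_dist (by simpa using hξ.le)
  have ha1 : ∀ ξ : Rn n, ‖ξ‖ ≤ 1 / 2 → a ξ = 1 := fun ξ hξ =>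
    a.one_of_mem_closedBall (mem_closedBall_zero_iff.2 hξ)
  have ha0 : ∀ ξ : Rn n, 3 / 5 ≤ ‖ξ‖ → a ξ = 0 := fun ξ hξ =>
    a.zero_of_le_dist (by simpa using hξ)
  refine ⟨φ₀, φ, ⟨?_, ?_, ?_, ?_, ?_, ?_, 1, one_pos, ?_, ?_⟩⟩
  · intro ξ
    simp [h₀]
  · intro ξ
    rw [h]
    exact Complex.ofReal_im _
  · intro ξ
    rw [h₀, Complex.ofReal_re]
    exact b.nonneg
  · intro ξ
    rw [h, Complex.ofReal_re]
    exact mul_nonneg b.nonneg (sub_nonneg.2 a.le_one)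
  · refine closure_minimal (fun ξ hξ => ?_) (isClosed_le continuous_norm continuous_const)
    by_contra hlt
    exact hξ (by rw [h₀, hb0 ξ (not_le.1 hlt), Complex.ofReal_zero])
  · refine closure_minimal (fun ξ hξ => ?_)
      ((isClosed_le continuous_const continuous_norm).inter
        (isClosed_le continuous_norm continuous_const))
    constructor
    · by_contra hlt
      exact hξ (by rw [h, ha1 ξ (not_le.1 hlt).le]; simp)
    · by_contra hlt
      exact hξ (by rw [h, hb0 ξ (not_le.1 hlt)]; simp)
  · intro ξ hξ
    simp [h₀, hb1 ξ hξ]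
  · intro ξ h1 h2
    rw [h, hb1 ξ h2, ha0 ξ h1]
    simp

end SpiralBesov

end

/-! The boundary of the spiral domain consists of a segment and two spirals of finite length,
because `1 / (θ log² θ)` is integrable at infinity. Hence the `δ`-neighbourhood of the boundary has
measure `O(δ)`, and `‖1_E(· - y) - 1_E‖₁ = O(|y|)`. As `∫ φ = 0`, this gives
`‖φ_j * 1_E‖₁ = O(2^{-j})`, that is, `1_E ∈ B¹_{1,∞}`, while `1_E ∈ B⁰_{∞,∞}` because `1_E` is
bounded. The other exponents follow from `‖f‖_p ≤ ‖f‖_∞^{1-1/p} ‖f‖₁^{1/p}`. -/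

noncomputable section

namespace SpiralBesov

section MinkowskiContent

open Metric

/-- Finiteness of the upper Minkowski content of codimension one of `A`: the open
`δ`-neighbourhood of `A` has measure `O(δ)` for `0 < δ ≤ 1`. -/
def HasFiniteMinkowskiContent {E : Type*} [PseudoMetricSpace E] [MeasurableSpace E]
    (μ : Measure E) (A : Set E) : Prop :=
  ∃ C : ℝ≥0∞, C ≠ ∞ ∧ ∀ δ : ℝ, 0 < δ → δ ≤ 1 → μ (thickening δ A) ≤ C * ENNReal.ofReal δ

namespace HasFiniteMinkowskiContent

variable {E : Type*} [PseudoMetricSpace E] [MeasurableSpace E] {μ : Measure E} {A B : Set E}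

theorem mono (hB : HasFiniteMinkowskiContent μ B) (hAB : A ⊆ B) :
    HasFiniteMinkowskiContent μ A := by
  obtain ⟨C, hC, hμ⟩ := hB
  exact ⟨C, hC, fun δ hδ hδ₁ =>
    (measure_mono (thickening_subset_of_subset δ hAB)).trans (hμ δ hδ hδ₁)⟩

theorem union (hA : HasFiniteMinkowskiContent μ A) (hB : HasFiniteMinkowskiContent μ B) :
    HasFiniteMinkowskiContent μ (A ∪ B) := by
  obtain ⟨C, hC, hA⟩ := hA
  obtain ⟨D, hD, hB⟩ := hB
  refine ⟨C + D, ENNReal.add_ne_top.2 ⟨hC, hD⟩, fun δ hδ hδ₁ => ?_⟩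
  rw [thickening_union, add_mul]
  exact (measure_union_le _ _).trans (add_le_add (hA δ hδ hδ₁) (hB δ hδ hδ₁))

theorem measure_eq_zero (hA : HasFiniteMinkowskiContent μ A) : μ A = 0 := by
  obtain ⟨C, hC, hμ⟩ := hA
  have hlim : Filter.Tendsto (fun δ => C * ENNReal.ofReal δ) (nhdsWithin 0 (Set.Ioi 0))
      (nhds 0) := by
    have : Filter.Tendsto (fun δ => C * ENNReal.ofReal δ) (nhds 0)
        (nhds (C * ENNReal.ofReal 0)) :=
      ENNReal.Tendsto.const_mul (ENNReal.continuous_ofReal.tendsto 0) (.inr hC)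
    simpa using this.mono_left nhdsWithin_le_nhds
  refine nonpos_iff_eq_zero.1 (ge_of_tendsto hlim ?_)
  filter_upwards [Ioc_mem_nhdsGT (zero_lt_one (α := ℝ))] with δ hδ
  exact (measure_mono (self_subset_thickening hδ.1 A)).trans (hμ δ hδ.1 hδ.2)

end HasFiniteMinkowskiContent

theorem exists_finset_cover_image {ι X : Type*} [PseudoMetricSpace X] {γ : ι → X} {F : ι → ℝ}
    {s : Set ι} {a b δ : ℝ} (hF : ∀ i ∈ s, F i ∈ Set.Icc a b)
    (hγ : ∀ i ∈ s, ∀ j ∈ s, dist (γ i) (γ j) ≤ dist (F i) (F j)) (hδ : 0 < δ) :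
    ∃ t : Finset X, t.card ≤ ⌊(b - a) / δ⌋₊ + 1 ∧ γ '' s ⊆ ⋃ c ∈ t, closedBall c δ := by
  classical
  obtain rfl | ⟨i₀, -⟩ := s.eq_empty_or_nonempty
  · exact ⟨∅, by simp⟩
  have : Nonempty ι := ⟨i₀⟩
  -- Group the indices by the cell of length `δ` in which `F i` lies, and pick one index per cell.
  let k : ι → ℕ := fun i => ⌊(F i - a) / δ⌋₊
  have hnonneg : ∀ i ∈ s, 0 ≤ (F i - a) / δ := fun i hi =>
    div_nonneg (sub_nonneg.2 (hF i hi).1) hδ.le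
  have hcell : ∀ i ∈ s, ∀ j ∈ s, k i = k j → dist (γ i) (γ j) ≤ δ := by
    intro i hi j hj hij
    have hlt : |(F i - a) / δ - (F j - a) / δ| < 1 := by
      apply Int.abs_sub_lt_one_of_floor_eq_floor
      rw [← Int.natCast_floor_eq_floor (hnonneg i hi), ← Int.natCast_floor_eq_floor (hnonneg j hj)]
      exact congrArg _ hij
    rw [← sub_div, sub_sub_sub_cancel_right, abs_div, abs_of_pos hδ, div_lt_one hδ] at hlt
    exact (hγ i hi j hj).trans hlt.le
  refine ⟨(Finset.range (⌊(b - a) / δ⌋₊ + 1)).image fun m => γ (Function.invFunOn k s m),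
    Finset.card_image_le.trans (Finset.card_range _).le, ?_⟩
  rintro _ ⟨i, hi, rfl⟩
  have hki : k i ∈ Finset.range (⌊(b - a) / δ⌋₊ + 1) := by
    have := (hF i hi).2
    rw [Finset.mem_range, Nat.lt_succ_iff]
    simp only [k]
    gcongr
  have hex : ∃ j ∈ s, k j = k i := ⟨i, hi, rfl⟩
  exact Set.mem_biUnion (Finset.mem_image_of_mem _ hki)
    (hcell i hi _ (Function.invFunOn_mem hex) (Function.invFunOn_eq hex).symm)

section HaarMeasure

variable {E : Type*} [NormedAddCommGroup E] [NormedSpace ℝ E] [FiniteDimensional ℝ E]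
  [MeasurableSpace E] [BorelSpace E] (μ : Measure E) [μ.IsAddHaarMeasure]

theorem measure_thickening_image_le {ι : Type*} {γ : ι → E} {F : ι → ℝ} {s : Set ι} {a b δ : ℝ}
    (hF : ∀ i ∈ s, F i ∈ Set.Icc a b)
    (hγ : ∀ i ∈ s, ∀ j ∈ s, dist (γ i) (γ j) ≤ dist (F i) (F j)) (hδ : 0 < δ) :
    μ (thickening δ (γ '' s)) ≤
      (⌊(b - a) / δ⌋₊ + 1 : ℕ) *
        (ENNReal.ofReal ((δ + δ) ^ Module.finrank ℝ E) * μ (ball 0 1)) := by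
  obtain ⟨t, ht, hcover⟩ := exists_finset_cover_image hF hγ hδ
  have hsub : thickening δ (γ '' s) ⊆ ⋃ c ∈ t, closedBall c (δ + δ) := by
    intro x hx
    obtain ⟨y, hy, hxy⟩ := mem_thickening_iff.1 hx
    obtain ⟨c, hc, hyc⟩ := Set.mem_iUnion₂.1 (hcover hy)
    exact Set.mem_biUnion hc ((dist_triangle x y c).trans (add_le_add hxy.le hyc))
  calc μ (thickening δ (γ '' s))
      ≤ ∑ c ∈ t, μ (closedBall c (δ + δ)) :=
        (measure_mono hsub).trans (measure_biUnion_finset_le _ _)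
    _ = t.card * (ENNReal.ofReal ((δ + δ) ^ Module.finrank ℝ E) * μ (ball 0 1)) := by
        simp only [Measure.addHaar_closedBall μ _ (add_pos hδ hδ).le, Finset.sum_const,
          nsmul_eq_mul]
    _ ≤ _ := by gcongr

theorem hasFiniteMinkowskiContent_image {ι : Type*} {γ : ι → E} {F : ι → ℝ} {s : Set ι}
    (hE : 2 ≤ Module.finrank ℝ E) (hF : Bornology.IsBounded (F '' s))
    (hγ : ∀ i ∈ s, ∀ j ∈ s, dist (γ i) (γ j) ≤ dist (F i) (F j)) :
    HasFiniteMinkowskiContent μ (γ '' s) := by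
  obtain ⟨R, hR, hFR⟩ := hF.subset_closedBall_lt 0 0
  rw [Real.closedBall_eq_Icc, zero_sub, zero_add] at hFR
  set n := Module.finrank ℝ E
  refine ⟨ENNReal.ofReal ((2 * R + 1) * 2 ^ n) * μ (ball 0 1),
    ENNReal.mul_ne_top ENNReal.ofReal_ne_top measure_ball_lt_top.ne, fun δ hδ hδ₁ => ?_⟩
  refine (measure_thickening_image_le μ (fun i hi => hFR ⟨i, hi, rfl⟩) hγ hδ).trans ?_
  have hcount : (⌊(R - -R) / δ⌋₊ + 1 : ℕ) * δ ≤ 2 * R + 1 := by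
    have := (le_div_iff₀ hδ).1 (Nat.floor_le (div_nonneg (by linarith : 0 ≤ R - -R) hδ.le))
    push_cast
    linarith
  have hpow : (δ + δ) ^ n ≤ 2 ^ n * δ * δ := by
    rw [← two_mul, mul_pow, mul_assoc, ← sq]
    exact mul_le_mul_of_nonneg_left (pow_le_pow_of_le_one hδ.le hδ₁ hE) (by positivity)
  rw [← ENNReal.ofReal_natCast, ← mul_assoc, mul_right_comm _ (μ _),
    ← ENNReal.ofReal_mul (by positivity), ← ENNReal.ofReal_mul (by positivity)]
  gcongr ENNReal.ofReal ?_ * _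
  calc (⌊(R - -R) / δ⌋₊ + 1 : ℕ) * (δ + δ) ^ n
      ≤ (⌊(R - -R) / δ⌋₊ + 1 : ℕ) * (2 ^ n * δ * δ) := by gcongr
    _ = (⌊(R - -R) / δ⌋₊ + 1 : ℕ) * δ * (2 ^ n * δ) := by ring
    _ ≤ (2 * R + 1) * (2 ^ n * δ) := by gcongr
    _ = (2 * R + 1) * 2 ^ n * δ := by ring

end HaarMeasure

theorem inter_frontier_nonempty_of_isPreconnected {X : Type*} [TopologicalSpace X] {s A : Set X}
    (hs : IsPreconnected s) (hA : (s ∩ A).Nonempty) (hA' : (s ∩ Aᶜ).Nonempty) :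
    (s ∩ frontier A).Nonempty := by
  by_contra! hfr
  have hcover : s ⊆ interior A ∪ interior Aᶜ := by
    rwa [← compl_frontier_eq_union_interior, Set.subset_compl_iff_disjoint_right,
      Set.disjoint_iff_inter_eq_empty]
  obtain ⟨x, hxs, hxA⟩ := hA
  obtain ⟨y, hys, hyA⟩ := hA'
  obtain ⟨z, -, hz, hz'⟩ := hs _ _ isOpen_interior isOpen_interior hcover
    ⟨x, hxs, (hcover hxs).resolve_right fun h => interior_subset h hxA⟩
    ⟨y, hys, (hcover hys).resolve_left fun h => hyA (interior_subset h)⟩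
  exact interior_subset hz' (interior_subset hz)

theorem symmDiff_translate_subset_thickening_frontier {E : Type*} [NormedAddCommGroup E]
    [NormedSpace ℝ E] (S : Set E) {y : E} (hy : y ≠ 0) :
    symmDiff ((· - y) ⁻¹' S) S ⊆ thickening (2 * ‖y‖) (frontier S) := by
  intro x hx
  have hpre : IsPreconnected (segment ℝ x (x - y)) := (convex_segment _ _).isPreconnected
  have hleft := left_mem_segment ℝ x (x - y)
  have hright := right_mem_segment ℝ x (x - y)
  obtain ⟨w, hw, hwS⟩ : (segment ℝ x (x - y) ∩ frontier S).Nonempty := by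
    rcases hx with ⟨hxy, hx⟩ | ⟨hx, hxy⟩
    · exact inter_frontier_nonempty_of_isPreconnected hpre ⟨_, hright, hxy⟩ ⟨_, hleft, hx⟩
    · exact inter_frontier_nonempty_of_isPreconnected hpre ⟨_, hleft, hx⟩ ⟨_, hright, hxy⟩
  refine mem_thickening_iff.2 ⟨w, hwS, ?_⟩
  have hdist : dist x w ≤ ‖y‖ := by
    simpa [dist_comm] using segment_subset_closedBall_left x (x - y) hw
  linarith [norm_pos_iff.2 hy]

theorem HasFiniteMinkowskiContent.exists_measure_symmDiff_translate_le {E : Type*}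
    [NormedAddCommGroup E] [NormedSpace ℝ E] [MeasurableSpace E] [BorelSpace E] {μ : Measure E}
    [μ.IsAddRightInvariant] {S : Set E} (hfr : HasFiniteMinkowskiContent μ (frontier S))
    (hS : μ S ≠ ∞) :
    ∃ K : ℝ≥0∞, K ≠ ∞ ∧ ∀ y, μ (symmDiff ((· - y) ⁻¹' S) S) ≤ K * ‖y‖ₑ := by
  obtain ⟨C, hC, hμ⟩ := hfr
  refine ⟨2 * C + 4 * μ S, ENNReal.add_ne_top.2 ⟨ENNReal.mul_ne_top ENNReal.ofNat_ne_top hC,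
    ENNReal.mul_ne_top ENNReal.ofNat_ne_top hS⟩, fun y => ?_⟩
  rw [add_mul]
  obtain rfl | hy := eq_or_ne y 0
  · simp
  obtain hy₁ | hy₁ := le_or_gt (2 * ‖y‖) 1
  · calc μ (symmDiff ((· - y) ⁻¹' S) S)
        ≤ μ (thickening (2 * ‖y‖) (frontier S)) :=
          measure_mono (symmDiff_translate_subset_thickening_frontier S hy)
      _ ≤ C * ENNReal.ofReal (2 * ‖y‖) := hμ _ (by positivity) hy₁
      _ = 2 * C * ‖y‖ₑ := by
          rw [ENNReal.ofReal_mul zero_le_two, ofReal_norm, ENNReal.ofReal_ofNat]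
          ring
      _ ≤ _ := le_self_add
  · have htwo : 1 ≤ 2 * ‖y‖ₑ := by
      rw [← ofReal_norm, ← ENNReal.ofReal_ofNat, ← ENNReal.ofReal_mul zero_le_two]
      exact ENNReal.one_le_ofReal.2 hy₁.le
    calc μ (symmDiff ((· - y) ⁻¹' S) S)
        ≤ μ ((· - y) ⁻¹' S) + μ S :=
          (measure_mono Set.symmDiff_subset_union).trans (measure_union_le _ _)
      _ = 2 * μ S * 1 := by
          simp only [sub_eq_add_neg, measure_preimage_add_right]
          ring
      _ ≤ 2 * μ S * (2 * ‖y‖ₑ) := by gcongr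
      _ = 4 * μ S * ‖y‖ₑ := by ring
      _ ≤ _ := le_add_self

end MinkowskiContent

section Dilation

variable {n : ℕ} (φ : 𝓢(Rn n, ℂ)) (j : ℕ)

theorem dilate_apply (x : Rn n) : dilate φ j x = 2 ^ (j * n) * φ ((2 : ℝ) ^ j • x) := by
  simp [dilate]

theorem lintegral_enorm_dilate_mul (h : Rn n → ℝ≥0∞) :
    ∫⁻ x, ‖dilate φ j x‖ₑ * h ((2 : ℝ) ^ j • x) = ∫⁻ x, ‖φ x‖ₑ * h x := by
  have hj : (2 : ℝ) ^ j ≠ 0 := by positivity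
  let e : Rn n ≃ᵐ Rn n := (Homeomorph.smulOfNeZero _ hj).toMeasurableEquiv
  have hjac : (2 : ℝ≥0∞) ^ (j * n) * ENNReal.ofReal |(((2 : ℝ) ^ j) ^ Module.finrank ℝ (Rn n))⁻¹|
      = 1 := by
    rw [abs_of_pos (by positivity), finrank_euclideanSpace_fin, ← pow_mul, ← ENNReal.ofReal_ofNat,
      ← ENNReal.ofReal_pow zero_le_two, ← ENNReal.ofReal_mul (by positivity),
      mul_inv_cancel₀ (by positivity), ENNReal.ofReal_one]
  calc ∫⁻ x, ‖dilate φ j x‖ₑ * h ((2 : ℝ) ^ j • x)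
      = ∫⁻ x, 2 ^ (j * n) * (‖φ (e x)‖ₑ * h (e x)) := by
        simp only [dilate_apply, enorm_mul, enorm_pow, mul_assoc]
        simp [e, enorm]
    _ = 2 ^ (j * n) * ∫⁻ x, ‖φ x‖ₑ * h x ∂volume.map e := by
        rw [lintegral_const_mul' _ _ (ENNReal.pow_ne_top ENNReal.ofNat_ne_top),
          lintegral_map_equiv (fun x => ‖φ x‖ₑ * h x)]
    _ = ∫⁻ x, ‖φ x‖ₑ * h x := by
        have : (volume : Measure (Rn n)).map e = _ := Measure.map_addHaar_smul volume hj
        rw [this, lintegral_smul_measure, smul_eq_mul, ← mul_assoc, Units.val_mk0, hjac, one_mul]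

theorem lintegral_enorm_dilate : ∫⁻ x, ‖dilate φ j x‖ₑ = ∫⁻ x, ‖φ x‖ₑ := by
  simpa using lintegral_enorm_dilate_mul φ j 1

theorem two_pow_mul_lintegral_enorm_dilate_mul_enorm :
    2 ^ j * ∫⁻ x, ‖dilate φ j x‖ₑ * ‖x‖ₑ = ∫⁻ x, ‖φ x‖ₑ * ‖x‖ₑ := by
  rw [← lintegral_enorm_dilate_mul φ j,
    ← lintegral_const_mul' _ _ (ENNReal.pow_ne_top ENNReal.ofNat_ne_top)]
  refine lintegral_congr fun x => ?_
  rw [enorm_smul, enorm_pow, Real.enorm_eq_ofReal zero_le_two, ENNReal.ofReal_ofNat,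
    mul_left_comm]

variable {φ} in
theorem integral_dilate_eq_zero (hφ : ∫ x, φ x = 0) : ∫ x, dilate φ j x = 0 := by
  simp only [dilate_apply]
  rw [integral_const_mul, Measure.integral_comp_smul volume (fun x => φ x), hφ, smul_zero,
    mul_zero]

end Dilation

theorem IsAdmissible.integral_eq_zero {n : ℕ} {φ₀ φ : 𝓢(Rn n, ℂ)} (h : IsAdmissible φ₀ φ) :
    ∫ x, φ x = 0 := by
  have hzero : fourierT φ 0 = 0 := by
    by_contra hne
    have := (h.supp (subset_tsupport _ hne)).1
    norm_num at this
  have hconst : (((2 * Real.pi) ^ (-(n : ℝ) / 2) : ℝ) : ℂ) ≠ 0 := by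
    exact_mod_cast (Real.rpow_pos_of_pos Real.two_pi_pos _).ne'
  simpa using (mul_eq_zero.1 hzero).resolve_left hconst

section Interpolation

theorem one_sub_toReal_one_div_nonneg {p : ℝ≥0∞} (hp : 1 ≤ p) : 0 ≤ 1 - (1 / p).toReal := by
  simpa using ENNReal.toReal_mono ENNReal.one_ne_top (ENNReal.inv_le_one.2 hp)

theorem eLpNorm_le_rpow_eLpNorm_top_mul_rpow_eLpNorm_one {α ε : Type*} [MeasurableSpace α]
    [ENorm ε] {μ : Measure α} {f : α → ε} (hf : eLpNorm f ∞ μ ≠ ∞) {p : ℝ≥0∞} (hp : 1 ≤ p) :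
    eLpNorm f p μ ≤ eLpNorm f ∞ μ ^ (1 - (1 / p).toReal) * eLpNorm f 1 μ ^ (1 / p).toReal := by
  obtain rfl | hp' := eq_or_ne p ∞
  · simp
  have hp₁ : 1 ≤ p.toReal := (ENNReal.toReal_one ▸ ENNReal.toReal_mono hp' hp :)
  have hp₀ : 0 < p.toReal := by linarith
  have hmain : ∫⁻ x, ‖f x‖ₑ ^ p.toReal ∂μ ≤ eLpNorm f ∞ μ ^ (p.toReal - 1) * eLpNorm f 1 μ := by
    rw [eLpNorm_one_eq_lintegral_enorm, ← lintegral_const_mul' _ _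
      (ENNReal.rpow_ne_top_of_nonneg (sub_nonneg.2 hp₁) hf)]
    refine lintegral_mono_ae ?_
    filter_upwards [enorm_ae_le_eLpNormEssSup f μ] with x hx
    calc ‖f x‖ₑ ^ p.toReal = ‖f x‖ₑ ^ (p.toReal - 1) * ‖f x‖ₑ := by
          conv_rhs => rw [← ENNReal.rpow_one ‖f x‖ₑ, ← ENNReal.rpow_mul, one_mul,
            ← ENNReal.rpow_add_of_nonneg _ _ (sub_nonneg.2 hp₁) zero_le_one, sub_add_cancel]
      _ ≤ eLpNorm f ∞ μ ^ (p.toReal - 1) * ‖f x‖ₑ := by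
          gcongr
          exact hx
  calc eLpNorm f p μ = (∫⁻ x, ‖f x‖ₑ ^ p.toReal ∂μ) ^ (1 / p.toReal) :=
        eLpNorm_eq_lintegral_rpow_enorm_toReal (zero_lt_one.trans_le hp).ne' hp'
    _ ≤ (eLpNorm f ∞ μ ^ (p.toReal - 1) * eLpNorm f 1 μ) ^ (1 / p.toReal) := by gcongr
    _ = _ := by
        rw [ENNReal.mul_rpow_of_nonneg _ _ (by positivity), ← ENNReal.rpow_mul, one_div p,
          ENNReal.toReal_inv, one_div, sub_mul, mul_inv_cancel₀ hp₀.ne', one_mul]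

variable {n : ℕ} {φ₀ φ : 𝓢(Rn n, ℂ)}

theorem besovNorm_top_eq_iSup (s : ℝ) (p : ℝ≥0∞) (f : 𝓢'(Rn n, ℂ)) :
    besovNorm φ₀ φ s p ∞ f =
      ⨆ j : ℕ, ENNReal.ofReal (2 ^ (j * s)) * eLpNorm (conv (resolution φ₀ φ j) f) p volume :=
  if_pos rfl

theorem besovNorm_le_rpow_mul_rpow {f : 𝓢'(Rn n, ℂ)} (hf : f ∈ besovSpace φ₀ φ 0 ∞ ∞)
    {p : ℝ≥0∞} (hp : 1 ≤ p) :
    besovNorm φ₀ φ (1 / p).toReal p ∞ f ≤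
      besovNorm φ₀ φ 0 ∞ ∞ f ^ (1 - (1 / p).toReal) *
        besovNorm φ₀ φ 1 1 ∞ f ^ (1 / p).toReal := by
  have hp₁ := one_sub_toReal_one_div_nonneg hp
  rw [besovNorm_top_eq_iSup]
  refine iSup_le fun j => ?_
  have htop : eLpNorm (conv (resolution φ₀ φ j) f) ∞ volume ≤ besovNorm φ₀ φ 0 ∞ ∞ f := by
    rw [besovNorm_top_eq_iSup]
    exact le_iSup_of_le j (by simp)
  have hone : ENNReal.ofReal (2 ^ j) * eLpNorm (conv (resolution φ₀ φ j) f) 1 volume ≤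
      besovNorm φ₀ φ 1 1 ∞ f := by
    rw [besovNorm_top_eq_iSup]
    exact le_iSup_of_le j (by simp)
  calc ENNReal.ofReal (2 ^ (j * (1 / p).toReal)) * eLpNorm (conv (resolution φ₀ φ j) f) p volume
      ≤ ENNReal.ofReal (2 ^ j) ^ (1 / p).toReal *
          (eLpNorm (conv (resolution φ₀ φ j) f) ∞ volume ^ (1 - (1 / p).toReal) *
            eLpNorm (conv (resolution φ₀ φ j) f) 1 volume ^ (1 / p).toReal) := by
        rw [Real.rpow_mul zero_le_two, Real.rpow_natCast,
          ENNReal.ofReal_rpow_of_nonneg (by positivity) ENNReal.toReal_nonneg]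
        gcongr
        exact eLpNorm_le_rpow_eLpNorm_top_mul_rpow_eLpNorm_one (htop.trans_lt hf).ne hp
    _ = eLpNorm (conv (resolution φ₀ φ j) f) ∞ volume ^ (1 - (1 / p).toReal) *
          (ENNReal.ofReal (2 ^ j) * eLpNorm (conv (resolution φ₀ φ j) f) 1 volume) ^
            (1 / p).toReal := by
        rw [ENNReal.mul_rpow_of_nonneg _ _ ENNReal.toReal_nonneg, mul_left_comm]
    _ ≤ _ := by gcongr

theorem besovSpace_inter_subset {p : ℝ≥0∞} (hp : 1 ≤ p) :
    besovSpace φ₀ φ 0 ∞ ∞ ∩ besovSpace φ₀ φ 1 1 ∞ ⊆ besovSpace φ₀ φ (1 / p).toReal p ∞ := by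
  rintro f ⟨htop, hone⟩
  refine (besovNorm_le_rpow_mul_rpow htop hp).trans_lt (ENNReal.mul_lt_top ?_ ?_)
  · exact ENNReal.rpow_lt_top_of_nonneg (one_sub_toReal_one_div_nonneg hp) htop.ne
  · exact ENNReal.rpow_lt_top_of_nonneg ENNReal.toReal_nonneg hone.ne

end Interpolation

section Convolution

theorem lintegral_enorm_integral_mul_le {α β 𝕜 : Type*} [MeasurableSpace α]
    [MeasurableSpace β] [RCLike 𝕜] {μ : Measure α} {ν : Measure β} [SFinite μ] [SFinite ν]
    {k : α → β → 𝕜} {f : β → 𝕜}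
    (hk : AEStronglyMeasurable (Function.uncurry k) (μ.prod ν)) (hf : AEStronglyMeasurable f ν) :
    ∫⁻ x, ‖∫ z, k x z * f z ∂ν‖ₑ ∂μ ≤ ∫⁻ z, (∫⁻ x, ‖k x z‖ₑ ∂μ) * ‖f z‖ₑ ∂ν := by
  calc ∫⁻ x, ‖∫ z, k x z * f z ∂ν‖ₑ ∂μ ≤ ∫⁻ x, ∫⁻ z, ‖k x z‖ₑ * ‖f z‖ₑ ∂ν ∂μ := by
        refine lintegral_mono fun x => (enorm_integral_le_lintegral_enorm _).trans_eq ?_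
        simp only [enorm_mul]
    _ = ∫⁻ z, ∫⁻ x, ‖k x z‖ₑ * ‖f z‖ₑ ∂μ ∂ν :=
        lintegral_lintegral_swap (hk.enorm.mul hf.comp_snd.enorm)
    _ = _ := lintegral_congr fun z => lintegral_mul_const' _ _ enorm_ne_top

variable {n : ℕ} {T : 𝓢'(Rn n, ℂ)} {g : Rn n → ℂ}

theorem exists_isRegularDistribution {q : ℝ≥0∞} [Fact (1 ≤ q)] (hg : MemLp g q volume) :
    ∃ T, IsRegularDistribution T g := by
  refine ⟨Lp.toTemperedDistribution hg.toLp, fun ψ => ⟨?_, ?_⟩⟩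
  · have := ENNReal.HolderConjugate.inv_one_sub_inv' (Fact.out : 1 ≤ q)
    exact hg.integrable_mul (ψ.memLp (1 - q⁻¹)⁻¹ volume)
  · rw [Lp.toTemperedDistribution_apply]
    refine integral_congr_ae ?_
    filter_upwards [hg.coeFn_toLp] with x hx
    rw [hx, smul_eq_mul, mul_comm]

namespace IsRegularDistribution

theorem conv_apply (hT : IsRegularDistribution T g) (ψ : 𝓢(Rn n, ℂ)) (x : Rn n) :
    conv ψ T x = ∫ z, g (x - z) * ψ z := by
  rw [conv, (hT _).2, ← integral_sub_left_eq_self _ volume x]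
  simp only [reflectAt_apply, sub_sub_cancel]

theorem integrable_comp_sub_mul (hT : IsRegularDistribution T g) (ψ : 𝓢(Rn n, ℂ)) (x : Rn n) :
    Integrable fun z => g (x - z) * ψ z := by
  have := (hT (reflectAt ψ x)).1.comp_sub_left x
  simpa only [reflectAt_apply, sub_sub_cancel] using this

theorem eLpNorm_conv_top_le (hT : IsRegularDistribution T g) (ψ : 𝓢(Rn n, ℂ)) :
    eLpNorm (conv ψ T) ∞ volume ≤ eLpNorm g ∞ volume * ∫⁻ z, ‖ψ z‖ₑ := by
  refine eLpNormEssSup_le_of_ae_enorm_bound (.of_forall fun x => ?_)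
  have hbound : ∀ᵐ z, ‖g (x - z)‖ₑ ≤ eLpNorm g ∞ volume :=
    (Measure.measurePreserving_sub_left volume x).quasiMeasurePreserving.ae
      (enorm_ae_le_eLpNormEssSup g volume)
  calc ‖conv ψ T x‖ₑ ≤ ∫⁻ z, ‖g (x - z)‖ₑ * ‖ψ z‖ₑ := by
        rw [hT.conv_apply]
        exact (enorm_integral_le_lintegral_enorm _).trans_eq (by simp only [enorm_mul])
    _ ≤ ∫⁻ z, eLpNorm g ∞ volume * ‖ψ z‖ₑ :=
        lintegral_mono_ae (hbound.mono fun z hz => by gcongr)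
    _ = _ := lintegral_const_mul _ ψ.continuous.enorm.measurable

theorem eLpNorm_conv_one_le (hT : IsRegularDistribution T g) (hg : AEStronglyMeasurable g volume)
    (ψ : 𝓢(Rn n, ℂ)) :
    eLpNorm (conv ψ T) 1 volume ≤ eLpNorm g 1 volume * ∫⁻ z, ‖ψ z‖ₑ := by
  simp only [eLpNorm_one_eq_lintegral_enorm, hT.conv_apply]
  refine (lintegral_enorm_integral_mul_le (k := fun x z => g (x - z))
    (hg.comp_quasiMeasurePreserving (quasiMeasurePreserving_sub_of_right_invariant _ _))
    ψ.continuous.aestronglyMeasurable).trans_eq ?_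
  simp only [lintegral_sub_right_eq_self (fun x => ‖g x‖ₑ)]
  exact lintegral_const_mul _ ψ.continuous.enorm.measurable

theorem eLpNorm_conv_one_le_of_integral_eq_zero (hT : IsRegularDistribution T g)
    (hg : AEStronglyMeasurable g volume) {K : ℝ≥0∞}
    (hK : ∀ y, ∫⁻ x, ‖g (x - y) - g x‖ₑ ≤ K * ‖y‖ₑ) {ψ : 𝓢(Rn n, ℂ)} (hψ : ∫ z, ψ z = 0) :
    eLpNorm (conv ψ T) 1 volume ≤ K * ∫⁻ z, ‖ψ z‖ₑ * ‖z‖ₑ := by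
  have hconv : ∀ x, conv ψ T x = ∫ z, (g (x - z) - g x) * ψ z := fun x => by
    simp only [sub_mul]
    rw [integral_sub (hT.integrable_comp_sub_mul ψ x) (ψ.integrable.const_mul _),
      integral_const_mul, hψ, mul_zero, sub_zero, hT.conv_apply]
  have hmeas : AEStronglyMeasurable (Function.uncurry fun x z => g (x - z) - g x)
      ((volume : Measure (Rn n)).prod (volume : Measure (Rn n))) :=
    (hg.comp_quasiMeasurePreserving (quasiMeasurePreserving_sub_of_right_invariant _ _)).sub
      hg.comp_fst
  simp only [eLpNorm_one_eq_lintegral_enorm, hconv]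
  calc ∫⁻ x, ‖∫ z, (g (x - z) - g x) * ψ z‖ₑ
      ≤ ∫⁻ z, (∫⁻ x, ‖g (x - z) - g x‖ₑ) * ‖ψ z‖ₑ :=
        lintegral_enorm_integral_mul_le hmeas ψ.continuous.aestronglyMeasurable
    _ ≤ ∫⁻ z, K * (‖ψ z‖ₑ * ‖z‖ₑ) := lintegral_mono fun z => by
        rw [← mul_assoc, mul_right_comm]
        gcongr
        exact hK z
    _ = _ := lintegral_const_mul _ (ψ.continuous.enorm.measurable.mul measurable_enorm)

variable {φ₀ φ : 𝓢(Rn n, ℂ)}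

theorem mem_besovSpace_zero_top_top (hT : IsRegularDistribution T g)
    (hg : eLpNorm g ∞ volume ≠ ∞) : T ∈ besovSpace φ₀ φ 0 ∞ ∞ := by
  let M := eLpNorm g ∞ volume * (∫⁻ z, ‖φ₀ z‖ₑ) + eLpNorm g ∞ volume * ∫⁻ z, ‖φ z‖ₑ
  have hM : M < ∞ := ENNReal.add_lt_top.2 ⟨ENNReal.mul_lt_top hg.lt_top φ₀.integrable.2,
    ENNReal.mul_lt_top hg.lt_top φ.integrable.2⟩
  refine lt_of_le_of_lt ?_ hM
  rw [besovNorm_top_eq_iSup]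
  refine iSup_le fun j => ?_
  rw [mul_zero, Real.rpow_zero, ENNReal.ofReal_one, one_mul]
  refine (hT.eLpNorm_conv_top_le _).trans ?_
  rw [resolution]
  split_ifs
  · exact le_self_add
  · rw [lintegral_enorm_dilate]
    exact le_add_self

theorem mem_besovSpace_one_one_top (hT : IsRegularDistribution T g) (hg : Integrable g)
    {K : ℝ≥0∞} (hK' : K ≠ ∞) (hK : ∀ y, ∫⁻ x, ‖g (x - y) - g x‖ₑ ≤ K * ‖y‖ₑ)
    (hφ : ∫ z, φ z = 0) : T ∈ besovSpace φ₀ φ 1 1 ∞ := by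
  have hmoment : ∫⁻ z, ‖φ z‖ₑ * ‖z‖ₑ < ∞ := by
    simpa [HasFiniteIntegral, enorm_mul, mul_comm] using (φ.integrable_pow_mul volume 1).2
  let N := eLpNorm g 1 volume * (∫⁻ z, ‖φ₀ z‖ₑ) + K * ∫⁻ z, ‖φ z‖ₑ * ‖z‖ₑ
  have hN : N < ∞ := ENNReal.add_lt_top.2
    ⟨ENNReal.mul_lt_top (memLp_one_iff_integrable.2 hg).2 φ₀.integrable.2,
      ENNReal.mul_lt_top hK'.lt_top hmoment⟩
  refine lt_of_le_of_lt ?_ hN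
  rw [besovNorm_top_eq_iSup]
  refine iSup_le fun j => ?_
  rw [mul_one, Real.rpow_natCast, ENNReal.ofReal_pow zero_le_two, ENNReal.ofReal_ofNat, resolution]
  split_ifs with hj
  · rw [hj, pow_zero, one_mul]
    exact (hT.eLpNorm_conv_one_le hg.1 φ₀).trans le_self_add
  · refine le_trans ?_ le_add_self
    rw [← two_pow_mul_lintegral_enorm_dilate_mul_enorm φ j, mul_left_comm K]
    gcongr
    exact hT.eLpNorm_conv_one_le_of_integral_eq_zero hg.1 hK (integral_dilate_eq_zero j hφ)

end IsRegularDistribution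

end Convolution

theorem lintegral_enorm_indicator_comp_sub_indicator_le {α : Type*} [MeasurableSpace α]
    (μ : Measure α) (f : α → α) (S : Set α) :
    ∫⁻ x, ‖S.indicator (fun _ => (1 : ℂ)) (f x) - S.indicator (fun _ => (1 : ℂ)) x‖ₑ ∂μ ≤
      μ (symmDiff (f ⁻¹' S) S) := by
  refine le_trans (lintegral_mono fun x => ?_) (lintegral_indicator_one_le _)
  by_cases hfx : f x ∈ S <;> by_cases hx : x ∈ S <;>
    simp [Set.indicator, Set.mem_symmDiff, hfx, hx]

theorem mem_image_frontier_of_subset_isCompact {X Y : Type*} [TopologicalSpace X] [R1Space X]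
    [TopologicalSpace Y] [T2Space Y] {f : X → Y} (hf : Continuous f) (hf' : IsOpenMap f)
    {D K : Set X} {z : Y} {V : Set Y} (hz : z ∈ frontier (f '' D)) (hV : IsOpen V) (hzV : z ∈ V)
    (hK : IsCompact K) (hDK : D ∩ f ⁻¹' V ⊆ K) : z ∈ f '' frontier D := by
  have hcl : z ∈ f '' closure (D ∩ f ⁻¹' V) := by
    rw [image_closure_of_isCompact (hK.closure_of_subset hDK) hf.continuousOn,
      Set.image_inter_preimage]
    exact hV.closure_inter ⟨hz.1, hzV⟩
  obtain ⟨w, hw, rfl⟩ := hcl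
  exact ⟨w, ⟨closure_mono Set.inter_subset_left hw, fun hint =>
    hz.2 (hf'.image_interior_subset D ⟨w, hint, rfl⟩)⟩, rfl⟩

theorem dist_le_dist_of_norm_deriv_le {E : Type*} [NormedAddCommGroup E] [NormedSpace ℝ E]
    {γ γ' : ℝ → E} {F F' : ℝ → ℝ} {s : Set ℝ} (hs : s.OrdConnected)
    (hγ : ∀ t ∈ s, HasDerivAt γ (γ' t) t) (hF : ∀ t ∈ s, HasDerivAt F (F' t) t)
    (hle : ∀ t ∈ s, ‖γ' t‖ ≤ F' t) :
    ∀ a ∈ s, ∀ b ∈ s, dist (γ a) (γ b) ≤ dist (F a) (F b) := by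
  suffices h : ∀ a ∈ s, ∀ b ∈ s, a ≤ b → ‖γ b - γ a‖ ≤ F b - F a by
    intro a ha b hb
    rcases le_total a b with hab | hab
    · rw [dist_comm, dist_eq_norm, dist_comm, Real.dist_eq]
      exact (h a ha b hb hab).trans (le_abs_self _)
    · rw [dist_eq_norm, Real.dist_eq]
      exact (h b hb a ha hab).trans (le_abs_self _)
  intro a ha b hb hab
  have hmem : ∀ t ∈ Set.Icc a b, t ∈ s := hs.out ha hb
  exact image_norm_le_of_norm_deriv_right_le_deriv_boundary'
    (f := fun t => γ t - γ a) (B := fun t => F t - F a)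
    (fun t ht => ((hγ t (hmem t ht)).sub_const _).continuousAt.continuousWithinAt)
    (fun t ht => ((hγ t (hmem t (Set.Ico_subset_Icc_self ht))).sub_const _).hasDerivWithinAt)
    (by simp)
    (fun t ht => ((hF t (hmem t ht)).sub_const _).continuousAt.continuousWithinAt)
    (fun t ht => ((hF t (hmem t (Set.Ico_subset_Icc_self ht))).sub_const _).hasDerivWithinAt)
    (fun t ht => hle t (hmem t (Set.Ico_subset_Icc_self ht))) (Set.right_mem_Icc.2 hab)

section Spiral

open Real (pi exp log)

/-- The function `θ ↦ 1 / (θ log² θ)` whose values at `θ` and `θ + π` bound the spiral domain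
at the angle `θ`. -/
def radius (θ : ℝ) : ℝ := 1 / (θ * log θ ^ 2)

/-- The outer spiral `r = radius θ` as a curve in the complex plane. -/
def spiral (θ : ℝ) : ℂ := radius θ * Complex.exp (θ * Complex.I)

/-- An antiderivative of `|radius'| + radius`, which dominates the speed of the spiral. -/
def lengthMajorant (θ : ℝ) : ℝ := -radius θ - 1 / log θ

variable {θ : ℝ}

theorem one_lt_of_two_pi_le (hθ : 2 * pi ≤ θ) : 1 < θ := by linarith [Real.pi_gt_three]

theorem one_le_log_of_two_pi_le (hθ : 2 * pi ≤ θ) : 1 ≤ log θ := by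
  rw [Real.le_log_iff_exp_le (by linarith [Real.pi_gt_three])]
  linarith [Real.exp_one_lt_three, Real.pi_gt_three]

theorem radius_pos (hθ : 1 < θ) : 0 < radius θ := by
  have := Real.log_pos hθ
  exact one_div_pos.2 (by positivity)

theorem radius_le_one_div (hθ : 2 * pi ≤ θ) : radius θ ≤ 1 / θ := by
  have hθ₀ : 0 < θ := one_pos.trans (one_lt_of_two_pi_le hθ)
  exact one_div_le_one_div_of_le hθ₀
    (le_mul_of_one_le_right hθ₀.le (one_le_pow₀ (one_le_log_of_two_pi_le hθ)))

theorem radius_le_one (hθ : 2 * pi ≤ θ) : radius θ ≤ 1 :=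
  (radius_le_one_div hθ).trans <|
    (div_le_one (one_pos.trans (one_lt_of_two_pi_le hθ))).2 (one_lt_of_two_pi_le hθ).le

theorem hasDerivAt_radius (hθ : 1 < θ) :
    HasDerivAt radius (-((log θ + 2) / (θ ^ 2 * log θ ^ 3))) θ := by
  have hlog := Real.log_pos hθ
  have hθ₀ : θ ≠ 0 := by positivity
  have hinv := ((hasDerivAt_id θ).mul ((Real.hasDerivAt_log hθ₀).pow 2)).inv
    (mul_ne_zero hθ₀ (pow_ne_zero 2 hlog.ne'))
  refine (hinv.congr_deriv ?_).congr_of_eventuallyEq (.of_forall fun t => one_div _)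
  simp only [Pi.mul_apply, Pi.pow_apply, id]
  field_simp
  ring

theorem hasDerivAt_one_div_log (hθ : 1 < θ) :
    HasDerivAt (fun t => 1 / log t) (-radius θ) θ := by
  have hlog := Real.log_pos hθ
  have hθ₀ : θ ≠ 0 := by positivity
  refine (((Real.hasDerivAt_log hθ₀).inv hlog.ne').congr_deriv ?_).congr_of_eventuallyEq
    (.of_forall fun t => one_div _)
  rw [radius]
  field_simp

theorem dist_spiral_le :
    ∀ a ∈ Set.Ioi 1, ∀ b ∈ Set.Ioi 1,
      dist (spiral a) (spiral b) ≤ dist (lengthMajorant a) (lengthMajorant b) := by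
  refine dist_le_dist_of_norm_deriv_le Set.ordConnected_Ioi
    (fun t ht => (hasDerivAt_radius ht).ofReal_comp.mul
      (((hasDerivAt_id t).ofReal_comp.mul_const Complex.I).cexp))
    (fun t ht => (hasDerivAt_radius ht).neg.sub (hasDerivAt_one_div_log ht))
    fun t (ht : 1 < t) => ?_
  have hlog := Real.log_pos ht
  refine (norm_add_le _ _).trans_eq ?_
  simp only [id, norm_mul, Complex.norm_exp_ofReal_mul_I, Complex.norm_real, Complex.norm_I,
    Real.norm_eq_abs, abs_neg, abs_of_pos (radius_pos ht), Complex.ofReal_one, norm_one, mul_one]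
  rw [abs_of_pos (by positivity)]
  ring

theorem isBounded_image_lengthMajorant :
    Bornology.IsBounded (lengthMajorant '' Set.Ici (2 * pi)) := by
  refine (Metric.isBounded_Icc (-2) 0).subset ?_
  rintro _ ⟨θ, hθ, rfl⟩
  have hlog := one_le_log_of_two_pi_le hθ
  have hlog' : 1 / log θ ≤ 1 := (div_le_one (by linarith)).2 hlog
  have : 0 < 1 / log θ := by positivity
  rw [lengthMajorant]
  constructor <;> linarith [radius_le_one hθ, radius_pos (one_lt_of_two_pi_le hθ)]

/-- The spiral domain in the coordinates `w = log r + i θ`, in which polar coordinates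
become the complex exponential, a continuous open map. -/
def logPolarSpiralDomain : Set ℂ :=
  {w | 2 * pi ≤ w.im ∧ radius (w.im + pi) ≤ exp w.re ∧ exp w.re < radius w.im}

/-- The isometry identifying the complex plane with `ℝ²`. -/
abbrev planeIso : ℂ ≃ₗᵢ[ℝ] Rn 2 := Complex.orthonormalBasisOneI.repr

theorem planeIso_mul_exp_mul_I (r θ : ℝ) :
    planeIso (r * Complex.exp (θ * Complex.I)) = !₂[r * Real.cos θ, r * Real.sin θ] := by
  refine WithLp.ofLp_injective _ ?_
  rw [Complex.orthonormalBasisOneI_repr_apply]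
  simp [Complex.exp_ofReal_mul_I_re, Complex.exp_ofReal_mul_I_im]

theorem exp_eq_exp_re_mul_exp_im (w : ℂ) :
    Complex.exp w = (exp w.re : ℝ) * Complex.exp (w.im * Complex.I) := by
  rw [Complex.ofReal_exp, ← Complex.exp_add, Complex.re_add_im]

theorem spiralDomain_eq_image :
    spiralDomain = planeIso '' (Complex.exp '' logPolarSpiralDomain) := by
  ext x
  constructor
  · rintro ⟨r, θ, hθ, hr, hr', rfl⟩
    have hr₀ : 0 < r :=
      (radius_pos (one_lt_of_two_pi_le (hθ.trans (by linarith [Real.pi_pos])))).trans_le hr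
    refine ⟨_, ⟨⟨log r, θ⟩, ⟨hθ, ?_, ?_⟩, rfl⟩, ?_⟩
    · rwa [Real.exp_log hr₀]
    · rwa [Real.exp_log hr₀]
    · rw [exp_eq_exp_re_mul_exp_im, Real.exp_log hr₀, planeIso_mul_exp_mul_I]
  · rintro ⟨_, ⟨w, ⟨hθ, hr, hr'⟩, rfl⟩, rfl⟩
    exact ⟨_, _, hθ, hr, hr', by rw [exp_eq_exp_re_mul_exp_im, planeIso_mul_exp_mul_I]⟩

theorem volume_spiralDomain_ne_top : volume spiralDomain ≠ ∞ := by
  have hsub : spiralDomain ⊆ Metric.closedBall 0 1 := by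
    rw [spiralDomain_eq_image]
    rintro _ ⟨_, ⟨w, ⟨hθ, -, hr⟩, rfl⟩, rfl⟩
    rw [mem_closedBall_zero_iff, LinearIsometryEquiv.norm_map, Complex.norm_exp]
    exact hr.le.trans (radius_le_one hθ)
  exact ((measure_mono hsub).trans_lt measure_closedBall_lt_top).ne

theorem continuousAt_radius_im {w : ℂ} (hw : 2 * pi ≤ w.im) :
    ContinuousAt (fun w : ℂ => radius w.im) w :=
  (hasDerivAt_radius (one_lt_of_two_pi_le hw)).continuousAt.comp Complex.continuous_im.continuousAt

theorem continuousAt_radius_im_add_pi {w : ℂ} (hw : 2 * pi ≤ w.im) :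
    ContinuousAt (fun w : ℂ => radius (w.im + pi)) w :=
  ContinuousAt.comp (g := radius) (f := fun w : ℂ => w.im + pi)
    (hasDerivAt_radius (by linarith [one_lt_of_two_pi_le hw, Real.pi_pos])).continuousAt
    (by fun_prop)

theorem closure_logPolarSpiralDomain_subset :
    closure logPolarSpiralDomain ⊆
      {w | 2 * pi ≤ w.im ∧ radius (w.im + pi) ≤ exp w.re ∧ exp w.re ≤ radius w.im} := by
  have hH : IsClosed {w : ℂ | 2 * pi ≤ w.im} := isClosed_le continuous_const Complex.continuous_im
  have hexp : Continuous fun w : ℂ => exp w.re := by fun_prop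
  have hclosed := (hH.isClosed_le
      (fun w hw => (continuousAt_radius_im_add_pi hw).continuousWithinAt) hexp.continuousOn).inter
    (hH.isClosed_le hexp.continuousOn
      fun w hw => (continuousAt_radius_im hw).continuousWithinAt)
  have hsub := (hclosed.closure_subset_iff (s := logPolarSpiralDomain)).2
    fun w hw => ⟨⟨hw.1, hw.2.1⟩, hw.1, hw.2.2.le⟩
  exact fun w hw => ⟨(hsub hw).1.1, (hsub hw).1.2, (hsub hw).2.2⟩

theorem mem_interior_logPolarSpiralDomain {w : ℂ} (him : 2 * pi < w.im)
    (hinner : radius (w.im + pi) < exp w.re) (houter : exp w.re < radius w.im) :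
    w ∈ interior logPolarSpiralDomain := by
  have hexp : ContinuousAt (fun w : ℂ => exp w.re) w := by fun_prop
  rw [mem_interior_iff_mem_nhds]
  filter_upwards [Complex.continuous_im.continuousAt.eventually_const_lt him,
    (continuousAt_radius_im_add_pi him.le).eventually_lt hexp hinner,
    hexp.eventually_lt (continuousAt_radius_im him.le) houter]
    with v h₁ h₂ h₃ using ⟨h₁.le, h₂.le, h₃⟩

theorem image_exp_frontier_logPolarSpiralDomain_subset :
    Complex.exp '' frontier logPolarSpiralDomain ⊆
      Complex.ofReal '' Set.Icc 0 1 ∪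
        (spiral '' Set.Ici (2 * pi) ∪ (fun θ => -spiral θ) '' Set.Ici (2 * pi)) := by
  rintro _ ⟨w, hw, rfl⟩
  obtain ⟨him, hinner, houter⟩ := closure_logPolarSpiralDomain_subset hw.1
  obtain hray | him' := him.eq_or_lt
  · refine .inl ⟨exp w.re, ⟨(Real.exp_pos _).le, houter.trans (radius_le_one him)⟩, ?_⟩
    rw [exp_eq_exp_re_mul_exp_im, ← hray]
    push_cast
    rw [Complex.exp_two_pi_mul_I, mul_one]
  obtain hinner | hinner' := hinner.eq_or_lt
  · refine .inr (.inr ⟨w.im + pi, him.trans (by linarith [Real.pi_pos]), ?_⟩)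
    rw [exp_eq_exp_re_mul_exp_im, ← hinner]
    simp only [spiral]
    push_cast
    rw [add_mul, Complex.exp_add, Complex.exp_pi_mul_I]
    ring
  obtain houter | houter' := houter.eq_or_lt
  · exact .inr (.inl ⟨w.im, him, by rw [exp_eq_exp_re_mul_exp_im, houter, spiral]⟩)
  · exact absurd (mem_interior_logPolarSpiralDomain him' hinner' houter') hw.2

theorem frontier_image_exp_subset :
    frontier (Complex.exp '' logPolarSpiralDomain) ⊆
      insert 0 (Complex.exp '' frontier logPolarSpiralDomain) := by
  intro z hz
  refine or_iff_not_imp_left.2 fun hz₀ => ?_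
  have hz' : 0 < ‖z‖ / 2 := half_pos (norm_pos_iff.2 hz₀)
  have hV : IsOpen {u : ℂ | ‖z‖ / 2 < ‖u‖} := isOpen_lt continuous_const continuous_norm
  -- Only finitely many turns of the spiral domain leave a given disc around the origin.
  refine mem_image_frontier_of_subset_isCompact Complex.continuous_exp Complex.isOpenMap_exp hz hV
    (half_lt_self (norm_pos_iff.2 hz₀)) ((isCompact_Icc (a := log (‖z‖ / 2)) (b := 0)).reProdIm
      (isCompact_Icc (a := 2 * pi) (b := 1 / (‖z‖ / 2)))) ?_
  rintro w ⟨⟨him, -, houter⟩, hw⟩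
  replace hw : ‖z‖ / 2 < exp w.re := Complex.norm_exp w ▸ hw
  refine ⟨⟨((Real.log_lt_iff_lt_exp hz').2 hw).le, ?_⟩, him, ?_⟩
  · exact Real.exp_le_one_iff.1 (houter.le.trans (radius_le_one him))
  · rw [le_one_div (one_pos.trans (one_lt_of_two_pi_le him)) hz']
    exact (hw.trans houter).le.trans (radius_le_one_div him)

theorem frontier_spiralDomain_subset :
    frontier spiralDomain ⊆ planeIso '' (Complex.ofReal '' Set.Icc 0 1 ∪
      (spiral '' Set.Ici (2 * pi) ∪ (fun θ => -spiral θ) '' Set.Ici (2 * pi))) := by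
  rw [spiralDomain_eq_image, ← planeIso.coe_toHomeomorph, ← Homeomorph.image_frontier]
  refine Set.image_mono (frontier_image_exp_subset.trans (Set.insert_subset ?_
    image_exp_frontier_logPolarSpiralDomain_subset))
  exact .inl ⟨0, by simp, Complex.ofReal_zero⟩

theorem hasFiniteMinkowskiContent_frontier_spiralDomain :
    HasFiniteMinkowskiContent volume (frontier spiralDomain) := by
  have hcurve : ∀ (γ : ℝ → ℂ) (F : ℝ → ℝ) (s : Set ℝ), Bornology.IsBounded (F '' s) →
      (∀ a ∈ s, ∀ b ∈ s, dist (γ a) (γ b) ≤ dist (F a) (F b)) →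
      HasFiniteMinkowskiContent volume (planeIso '' (γ '' s)) := fun γ F s hF hγ => by
    rw [Set.image_image]
    exact hasFiniteMinkowskiContent_image volume finrank_euclideanSpace_fin.ge hF
      fun a ha b hb => (planeIso.dist_map _ _).trans_le (hγ a ha b hb)
  have hsegment := hcurve Complex.ofReal id (Set.Icc 0 1) (by simp [Metric.isBounded_Icc])
    fun a _ b _ => (Complex.isometry_ofReal.dist_eq a b).le
  have hspiral : ∀ a ∈ Set.Ici (2 * pi), ∀ b ∈ Set.Ici (2 * pi),
      dist (spiral a) (spiral b) ≤ dist (lengthMajorant a) (lengthMajorant b) :=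
    fun a ha b hb => dist_spiral_le a (one_lt_of_two_pi_le ha) b (one_lt_of_two_pi_le hb)
  have houter := hcurve spiral _ _ isBounded_image_lengthMajorant hspiral
  have hinner := hcurve (fun θ => -spiral θ) _ _ isBounded_image_lengthMajorant
    fun a ha b hb => (dist_neg_neg _ _).trans_le (hspiral a ha b hb)
  refine (hsegment.union (houter.union hinner)).mono ?_
  rw [← Set.image_union, ← Set.image_union]
  exact frontier_spiralDomain_subset

end Spiral

end SpiralBesov

end

theorem theorem4p18_general {n : ℕ} {S : Set (SpiralBesov.Rn n)} (hS : volume S ≠ ∞)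
    (hfr : SpiralBesov.HasFiniteMinkowskiContent volume (frontier S)) :
    ∃ T : 𝓢'(SpiralBesov.Rn n, ℂ),
      SpiralBesov.IsRegularDistribution T (S.indicator fun _ => (1 : ℂ)) ∧
      ∀ φ₀ φ : 𝓢(SpiralBesov.Rn n, ℂ), ∫ x, φ x = 0 → ∀ p : ℝ≥0∞, 1 ≤ p →
        T ∈ SpiralBesov.besovSpace φ₀ φ (1 / p).toReal p ∞ := by
  have hmeas : NullMeasurableSet S volume := nullMeasurableSet_of_null_frontier hfr.measure_eq_zero
  have hint : Integrable (S.indicator fun _ => (1 : ℂ)) :=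
    (integrableOn_const hS).integrable_indicator₀ hmeas
  have hbdd : eLpNorm (S.indicator fun _ => (1 : ℂ)) ∞ volume ≠ ∞ :=
    ((eLpNormEssSup_indicator_const_le S 1).trans_lt enorm_lt_top).ne
  obtain ⟨K, hK, htranslate⟩ := hfr.exists_measure_symmDiff_translate_le hS
  obtain ⟨T, hT⟩ := SpiralBesov.exists_isRegularDistribution (memLp_one_iff_integrable.2 hint)
  refine ⟨T, hT, fun φ₀ φ hφ p hp => SpiralBesov.besovSpace_inter_subset hp ⟨?_, ?_⟩⟩
  · exact hT.mem_besovSpace_zero_top_top hbdd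
  · exact hT.mem_besovSpace_one_one_top hint hK (fun y =>
      (SpiralBesov.lintegral_enorm_indicator_comp_sub_indicator_le volume (· - y) S).trans
        (htranslate y)) hφ

/-- The characteristic function of the spiral-type domain, regarded as a tempered distribution,
belongs to `B^{1/p}_{p,∞}(ℝ²)` for every `p ∈ [1, ∞]` (with `1/∞ = 0`), for every admissible pair
used to define the Besov spaces. -/
theorem theorem4p18 :
    ∃ T : 𝓢'(SpiralBesov.Rn 2, ℂ),
      SpiralBesov.IsRegularDistribution T
        (Set.indicator SpiralBesov.spiralDomain (fun _ => (1 : ℂ))) ∧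
      ∀ φ₀ φ : 𝓢(SpiralBesov.Rn 2, ℂ), SpiralBesov.IsAdmissible φ₀ φ →
        ∀ p : ℝ≥0∞, 1 ≤ p →
          T ∈ SpiralBesov.besovSpace φ₀ φ (1 / p).toReal p ∞ := by
  obtain ⟨T, hT, h⟩ := theorem4p18_general SpiralBesov.volume_spiralDomain_ne_top
    SpiralBesov.hasFiniteMinkowskiContent_frontier_spiralDomain
  exact ⟨T, hT, fun φ₀ φ hφ p hp => h φ₀ φ hφ.integral_eq_zero p hp⟩
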